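/- Let $R$ be a commutative Noetherian local ring, $\mathfrak a$ an ideal of $R$, $M$ a finitely generated $R$-module of projective dimension $\operatorname{pd}_R M=d<\infty$ (so $M\neq 0$ and $d\in\mathbb N_0$), and $N$ an $R$-module, not necessarily finitely generated, with $\dim_R N=\dim R=n$, where $\dim_R N$ is the supremum of $\dim R/\mathfrak p$ over $\mathfrak p\in\operatorname{Supp}_R N$. For $R$-modules $X,Y$ put $$H^i_{\mathfrak a}(X,Y)=\varinjlim_k \operatorname{Ext}^i_R(X/\mathfrak a^kX,Y),\qquad \operatorname{cd}(\mathfrak a,X,Y)=\sup\{i\mid H^i_{\mathfrak a}(X,Y)\neq 0\}$$ (with $\sup\varnothing=-\infty$). Call a nonzero $R$-module secondary if multiplication by each element of $R$ on it is either surjective or nilpotent; an $R$-module $L$ has a secondary representation if it is a finite (possibly empty, when $L=0$) sum of secondary submodules; and $\operatorname{Att}_R(L)$ is the set of prime ideals of the form $(K:_RL)$ with $K$ a submodule of $L$. Then $H^{d+n}_{\mathfrak a}(M,N)$ has a secondary representation, and $$\operatorname{Att}_R\bigl(H^{d+n}_{\mathfrak a}(M,N)\bigr)\subseteq\{\mathfrak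 p\in\operatorname{Ass}_R(N)\mid \operatorname{cd}(\mathfrak a,M,R/\mathfrak p)=d+n\}.$$ -/

import Mathlib

open CategoryTheory

universe u

noncomputable section

section GeneralizedLocalCohomology

variable {R : Type u} [CommRing R]

/-- The natural surjection `M / 𝔞 ^ j M → M / 𝔞 ^ i M` for `i ≤ j`. -/
def quotPowMap (𝔞 : Ideal R) (M : Type u) [AddCommGroup M] [Module R M] {i j : ℕ} (h : i ≤ j) :
    (M ⧸ (𝔞 ^ j • ⊤ : Submodule R M)) →ₗ[R] (M ⧸ (𝔞 ^ i • ⊤ : Submodule R M)) :=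
  Submodule.factor (Submodule.smul_mono_left (Ideal.pow_le_pow_right h))

/-- The `R`-module `Ext^i_R(M / 𝔞 ^ k M, N)`. -/
abbrev ExtQuotPow (𝔞 : Ideal R) (M N : Type u) [AddCommGroup M] [Module R M]
    [AddCommGroup N] [Module R N] (i k : ℕ) : Type u :=
  Abelian.Ext.{u} (ModuleCat.of R (M ⧸ (𝔞 ^ k • ⊤ : Submodule R M))) (ModuleCat.of R N) i

/-- The map `Ext^i_R(M / 𝔞 ^ k M, N) → Ext^i_R(M / 𝔞 ^ l M, N)`, for `k ≤ l`, induced by the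
natural surjection `M / 𝔞 ^ l M → M / 𝔞 ^ k M`. -/
def extQuotPowMap (𝔞 : Ideal R) (M N : Type u) [AddCommGroup M] [Module R M]
    [AddCommGroup N] [Module R N] (i k l : ℕ) (h : k ≤ l) :
    ExtQuotPow 𝔞 M N i k →ₗ[R] ExtQuotPow 𝔞 M N i l where
  toFun x := (Abelian.Ext.mk₀ (ModuleCat.ofHom (quotPowMap 𝔞 M h))).comp x (zero_add i)
  map_add' x y := by simp
  map_smul' r x := by simp

/-- The maps above form a directed system. -/
instance extQuotPow_directedSystem (𝔞 : Ideal R) (M N : Type u) [AddCommGroup M] [Module R M]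
    [AddCommGroup N] [Module R N] (i : ℕ) :
    DirectedSystem (ExtQuotPow 𝔞 M N i) (fun k l h => extQuotPowMap 𝔞 M N i k l h) where
  map_self k x := by
    have : ModuleCat.ofHom (quotPowMap 𝔞 M (le_refl k)) = 𝟙 _ := by
      ext x
      rfl
    simp [extQuotPowMap, this]
  map_map k l m hkl hlm x := by
    have : ModuleCat.ofHom (quotPowMap 𝔞 M hlm) ≫ ModuleCat.ofHom (quotPowMap 𝔞 M hkl) =
        ModuleCat.ofHom (quotPowMap 𝔞 M (hkl.trans hlm)) := by
      ext x
      rfl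
    simp [extQuotPowMap, ← this]

/-- The generalized local cohomology module `H^i_𝔞(M, N) = colim_k Ext^i_R(M / 𝔞 ^ k M, N)`. -/
abbrev GenLocalCohomology (𝔞 : Ideal R) (i : ℕ) (M N : Type u) [AddCommGroup M] [Module R M]
    [AddCommGroup N] [Module R N] : Type u :=
  Module.DirectLimit (ExtQuotPow 𝔞 M N i) (extQuotPowMap 𝔞 M N i)

/-- `cd(𝔞, M, N) = sup {i | H^i_𝔞(M, N) ≠ 0}`; it is `⊥` if all these modules vanish. -/
def genCohomDim (𝔞 : Ideal R) (M N : Type u) [AddCommGroup M] [Module R M]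
    [AddCommGroup N] [Module R N] : WithBot ℕ∞ :=
  sSup {c : WithBot ℕ∞ | ∃ i : ℕ, c = i ∧ Nontrivial (GenLocalCohomology 𝔞 i M N)}

end GeneralizedLocalCohomology

section Secondary

variable (R : Type*) [CommRing R] (L : Type*) [AddCommGroup L] [Module R L]

/-- A nonzero module is secondary if multiplication by each ring element is surjective or
nilpotent. -/
def IsSecondaryModule : Prop :=
  Nontrivial L ∧ ∀ x : R, Function.Surjective (LinearMap.lsmul R L x) ∨
    IsNilpotent (LinearMap.lsmul R L x : Module.End R L)

/-- `L = L₁ + ⋯ + Lₛ` is a finite sum of secondary submodules. The empty sum is allowed, so that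
the zero module has a secondary representation. -/
def HasSecondaryRepresentation : Prop :=
  ∃ (s : ℕ) (S : Fin s → Submodule R L), (∀ i, IsSecondaryModule R (S i)) ∧ ⨆ i, S i = ⊤

/-- The set of attached primes: the primes of the form `(K :_R L)` with `K` a submodule of `L`. -/
def attachedPrimes : Set (Ideal R) :=
  {p | p.IsPrime ∧ ∃ K : Submodule R L, p = K.colon Set.univ}

end Secondary

end

/-! Write T for the functor sending X to H^{d+n}_𝔞(M, X). Everything rests on a vanishing theorem,
`genLocalCohomology_subsingleton_of_supportDim_lt`: H^i_𝔞(M, X) = 0 for i ≥ d + e once dim X < e.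
Hence T is right exact, and it kills every module whose support contains no minimal prime of R,
since such a module has dimension < n.

For each minimal prime p let N_p ⊆ N consist of the elements vanishing locally at all the other
minimal primes. The sum of the N_p exhausts N up to a quotient killed by T, so T(N) is the sum of
the images of the T(N_p). An x outside p acts surjectively on T(N_p), because T kills N_p / xN_p; an
x in p acts nilpotently, because T kills x^k N_p for some k. The nonzero images are therefore
secondary, and every attached prime is one of these p. If p were not associated to N, then N_p would
vanish at p as well, and T(N_p) = 0.

For the condition on cd, let P = (K : T(N)) be prime with T(R/P) = 0. Right exactness and reduction
to finitely generated modules show that T kills all modules annihilated by P, in particular N / PN.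
Hence T(N) = P T(N) ⊆ K, which is absurd. -/

/-! ### Functoriality and exactness in the second variable. -/

section ExtFunctoriality

variable {R : Type u} [CommRing R]

/-- The `R`-linear map `Ext^i(X, N) → Ext^i(X, N')` induced by `f : N → N'`. -/
noncomputable def extPostcomp (X : ModuleCat.{u} R) (i : ℕ) {N N' : Type u} [AddCommGroup N]
    [Module R N] [AddCommGroup N'] [Module R N'] (f : N →ₗ[R] N') :
    Abelian.Ext.{u} X (ModuleCat.of R N) i →ₗ[R] Abelian.Ext.{u} X (ModuleCat.of R N') i where
  toFun x := x.comp (Abelian.Ext.mk₀ (ModuleCat.ofHom f)) (add_zero i)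
  map_add' x y := by simp
  map_smul' r x := by simp

variable (𝔞 : Ideal R) (i : ℕ) (M : Type u) [AddCommGroup M] [Module R M]
variable {N N' N'' : Type u} [AddCommGroup N] [Module R N] [AddCommGroup N'] [Module R N']
  [AddCommGroup N''] [Module R N'']

lemma extPostcomp_extQuotPowMap (f : N →ₗ[R] N') {k l : ℕ} (h : k ≤ l)
    (x : ExtQuotPow 𝔞 M N i k) :
    extPostcomp _ i f (extQuotPowMap 𝔞 M N i k l h x) =
      extQuotPowMap 𝔞 M N' i k l h (extPostcomp _ i f x) := by
  simp only [extPostcomp, extQuotPowMap, LinearMap.coe_mk, AddHom.coe_mk]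
  rw [Abelian.Ext.comp_assoc _ _ _ _ _ (by omega)]

/-- The map `H^i_𝔞(M, N) → H^i_𝔞(M, N')` induced by `f : N → N'`. -/
noncomputable def genLocalCohomologyMap (f : N →ₗ[R] N') :
    GenLocalCohomology 𝔞 i M N →ₗ[R] GenLocalCohomology 𝔞 i M N' :=
  Module.DirectLimit.map (fun _ ↦ extPostcomp _ i f) fun _ _ h ↦
    LinearMap.ext fun x ↦ extPostcomp_extQuotPowMap 𝔞 i M f h x

/-- The canonical map `Ext^i(M / 𝔞 ^ k M, N) → H^i_𝔞(M, N)`. -/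
noncomputable abbrev GenLocalCohomology.of (N : Type u) [AddCommGroup N] [Module R N] (k : ℕ) :
    ExtQuotPow 𝔞 M N i k →ₗ[R] GenLocalCohomology 𝔞 i M N :=
  Module.DirectLimit.of R ℕ (ExtQuotPow 𝔞 M N i) (extQuotPowMap 𝔞 M N i) k

lemma genLocalCohomologyMap_of (f : N →ₗ[R] N') (k : ℕ) (x : ExtQuotPow 𝔞 M N i k) :
    genLocalCohomologyMap 𝔞 i M f (GenLocalCohomology.of 𝔞 i M N k x) =
      GenLocalCohomology.of 𝔞 i M N' k (extPostcomp _ i f x) :=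
  Module.DirectLimit.map_apply_of _ _ _

lemma GenLocalCohomology.of_map {k l : ℕ} (h : k ≤ l) (x : ExtQuotPow 𝔞 M N i k) :
    GenLocalCohomology.of 𝔞 i M N l (extQuotPowMap 𝔞 M N i k l h x) =
      GenLocalCohomology.of 𝔞 i M N k x :=
  Module.DirectLimit.of_f

lemma GenLocalCohomology.exists_of (z : GenLocalCohomology 𝔞 i M N) :
    ∃ k x, GenLocalCohomology.of 𝔞 i M N k x = z :=
  Module.DirectLimit.exists_of z

lemma GenLocalCohomology.exists_map_eq_zero {k : ℕ} {x : ExtQuotPow 𝔞 M N i k}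
    (hx : GenLocalCohomology.of 𝔞 i M N k x = 0) :
    ∃ l, ∃ h : k ≤ l, extQuotPowMap 𝔞 M N i k l h x = 0 :=
  Module.DirectLimit.of.zero_exact hx

lemma genLocalCohomologyMap_id :
    genLocalCohomologyMap 𝔞 i M (LinearMap.id : N →ₗ[R] N) = LinearMap.id := by
  refine LinearMap.ext fun z ↦ ?_
  obtain ⟨k, x, rfl⟩ := GenLocalCohomology.exists_of 𝔞 i M z
  rw [genLocalCohomologyMap_of]
  exact congrArg _ x.comp_mk₀_id

lemma genLocalCohomologyMap_comp (g : N' →ₗ[R] N'') (f : N →ₗ[R] N') :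
    genLocalCohomologyMap 𝔞 i M (g ∘ₗ f) =
      genLocalCohomologyMap 𝔞 i M g ∘ₗ genLocalCohomologyMap 𝔞 i M f := by
  refine LinearMap.ext fun z ↦ ?_
  obtain ⟨k, x, rfl⟩ := GenLocalCohomology.exists_of 𝔞 i M z
  simp only [LinearMap.comp_apply, genLocalCohomologyMap_of]
  simp [extPostcomp, ModuleCat.ofHom_comp, ← Abelian.Ext.mk₀_comp_mk₀]

lemma genLocalCohomologyMap_add (f g : N →ₗ[R] N') :
    genLocalCohomologyMap 𝔞 i M (f + g) =
      genLocalCohomologyMap 𝔞 i M f + genLocalCohomologyMap 𝔞 i M g := by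
  refine LinearMap.ext fun z ↦ ?_
  obtain ⟨k, x, rfl⟩ := GenLocalCohomology.exists_of 𝔞 i M z
  simp only [LinearMap.add_apply, genLocalCohomologyMap_of, ← map_add]
  simp [extPostcomp, ModuleCat.ofHom_add, Abelian.Ext.mk₀_add]

lemma genLocalCohomologyMap_smul (r : R) (f : N →ₗ[R] N') :
    genLocalCohomologyMap 𝔞 i M (r • f) = r • genLocalCohomologyMap 𝔞 i M f := by
  refine LinearMap.ext fun z ↦ ?_
  obtain ⟨k, x, rfl⟩ := GenLocalCohomology.exists_of 𝔞 i M z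
  simp only [LinearMap.smul_apply, genLocalCohomologyMap_of, ← map_smul]
  have : ModuleCat.ofHom (r • f) = r • ModuleCat.ofHom f := rfl
  simp [extPostcomp, this, Abelian.Ext.mk₀_smul]

/-- `N ↦ H^i_𝔞(M, N)` as an `R`-linear map on homomorphisms. -/
noncomputable def genLocalCohomologyMapLinear :
    (N →ₗ[R] N') →ₗ[R] GenLocalCohomology 𝔞 i M N →ₗ[R] GenLocalCohomology 𝔞 i M N' where
  toFun := genLocalCohomologyMap 𝔞 i M
  map_add' := genLocalCohomologyMap_add 𝔞 i M
  map_smul' := genLocalCohomologyMap_smul 𝔞 i M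

lemma genLocalCohomologyMap_zero : genLocalCohomologyMap 𝔞 i M (0 : N →ₗ[R] N') = 0 :=
  map_zero (genLocalCohomologyMapLinear 𝔞 i M)

lemma genLocalCohomologyMap_sum {ι : Type*} (s : Finset ι) (f : ι → N →ₗ[R] N') :
    genLocalCohomologyMap 𝔞 i M (∑ j ∈ s, f j) = ∑ j ∈ s, genLocalCohomologyMap 𝔞 i M (f j) :=
  map_sum (genLocalCohomologyMapLinear 𝔞 i M) _ _

lemma genLocalCohomologyMap_lsmul (r : R) (z : GenLocalCohomology 𝔞 i M N) :
    genLocalCohomologyMap 𝔞 i M (LinearMap.lsmul R N r) z = r • z := by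
  have : LinearMap.lsmul R N r = r • LinearMap.id := rfl
  rw [this, genLocalCohomologyMap_smul, genLocalCohomologyMap_id]
  rfl

lemma genLocalCohomology_subsingleton_of_subsingleton [Subsingleton N] :
    Subsingleton (GenLocalCohomology 𝔞 i M N) := by
  refine subsingleton_of_forall_eq 0 fun z ↦ ?_
  rw [← LinearMap.id_apply (R := R) z, ← genLocalCohomologyMap_id,
    Subsingleton.elim (LinearMap.id : N →ₗ[R] N) 0, genLocalCohomologyMap_zero,
    LinearMap.zero_apply]

/-- Every element of `H^i_𝔞(M, N)` is annihilated by a power of `𝔞`. -/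
lemma GenLocalCohomology.exists_pow_smul_eq_zero (z : GenLocalCohomology 𝔞 i M N) :
    ∃ k : ℕ, ∀ r ∈ 𝔞 ^ k, r • z = 0 := by
  obtain ⟨k, x, rfl⟩ := GenLocalCohomology.exists_of 𝔞 i M z
  refine ⟨k, fun r hr ↦ ?_⟩
  -- Scalars act on Ext through the first argument, where r ∈ 𝔞^k acts as zero.
  have h0 : r • 𝟙 (ModuleCat.of R (M ⧸ (𝔞 ^ k • ⊤ : Submodule R M))) = 0 := by
    ext y
    exact (Submodule.Quotient.mk_eq_zero _).mpr (Submodule.smul_mem_smul hr trivial)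
  rw [← map_smul]
  have : r • x = (Abelian.Ext.mk₀ (r • 𝟙 _)).comp x (zero_add i) := by
    simp [Abelian.Ext.mk₀_smul]
  rw [this, h0]
  simp

section Exactness

variable {f : N →ₗ[R] N'} {g : N' →ₗ[R] N''}

/-- The short exact sequence of module categories attached to exact linear maps. -/
lemma shortExact_of_exact (hf : Function.Injective f) (hfg : Function.Exact f g)
    (hg : Function.Surjective g) :
    (ModuleCat.shortComplexOfCompEqZero f g hfg.linearMap_comp_eq_zero).ShortExact :=
  ModuleCat.shortComplex_shortExact _ hfg hf hg

/-- A class that dies in the colimit already dies at a finite stage, so exactness passes from the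
long exact Ext sequence to the limit. -/
lemma genLocalCohomologyMap_exact (hf : Function.Injective f) (hfg : Function.Exact f g)
    (hg : Function.Surjective g) (z : GenLocalCohomology 𝔞 i M N')
    (hz : genLocalCohomologyMap 𝔞 i M g z = 0) :
    ∃ y, genLocalCohomologyMap 𝔞 i M f y = z := by
  obtain ⟨k, x, rfl⟩ := GenLocalCohomology.exists_of 𝔞 i M z
  rw [genLocalCohomologyMap_of] at hz
  obtain ⟨l, h, hl⟩ := GenLocalCohomology.exists_map_eq_zero 𝔞 i M hz
  rw [← extPostcomp_extQuotPowMap] at hl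
  obtain ⟨y, hy⟩ := Abelian.Ext.covariant_sequence_exact₂ _ (shortExact_of_exact hf hfg hg)
    (extQuotPowMap 𝔞 M N' i k l h x) hl
  refine ⟨GenLocalCohomology.of 𝔞 i M N l y, ?_⟩
  rw [genLocalCohomologyMap_of, ← GenLocalCohomology.of_map 𝔞 i M h]
  exact congrArg _ hy

lemma genLocalCohomologyMap_surjective (hf : Function.Injective f) (hfg : Function.Exact f g)
    (hg : Function.Surjective g) [Subsingleton (GenLocalCohomology 𝔞 (i + 1) M N)] :
    Function.Surjective (genLocalCohomologyMap 𝔞 i M g) := by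
  intro z
  obtain ⟨k, x, rfl⟩ := GenLocalCohomology.exists_of 𝔞 i M z
  have hS := shortExact_of_exact hf hfg hg
  obtain ⟨l, h, hl⟩ := GenLocalCohomology.exists_map_eq_zero 𝔞 (i + 1) M
    (x := x.comp hS.extClass rfl) (Subsingleton.elim _ _)
  obtain ⟨y, hy⟩ := Abelian.Ext.covariant_sequence_exact₃ _ hS
    (extQuotPowMap 𝔞 M N'' i k l h x) rfl (by
      rw [← hl]
      exact Abelian.Ext.comp_assoc _ _ _ (zero_add i) rfl (by omega))
  refine ⟨GenLocalCohomology.of 𝔞 i M N' l y, ?_⟩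
  rw [genLocalCohomologyMap_of, ← GenLocalCohomology.of_map 𝔞 i M h]
  exact congrArg _ hy

lemma genLocalCohomologyMap_injective (hf : Function.Injective f) (hfg : Function.Exact f g)
    (hg : Function.Surjective g) [Subsingleton (GenLocalCohomology 𝔞 i M N'')] :
    Function.Injective (genLocalCohomologyMap 𝔞 (i + 1) M f) := by
  rw [injective_iff_map_eq_zero]
  intro z hz
  obtain ⟨k, x, rfl⟩ := GenLocalCohomology.exists_of 𝔞 (i + 1) M z
  have hS := shortExact_of_exact hf hfg hg
  rw [genLocalCohomologyMap_of] at hz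
  obtain ⟨l, h, hl⟩ := GenLocalCohomology.exists_map_eq_zero 𝔞 (i + 1) M hz
  rw [← extPostcomp_extQuotPowMap] at hl
  obtain ⟨y, hy⟩ := Abelian.Ext.covariant_sequence_exact₁ _ hS
    (extQuotPowMap 𝔞 M N (i + 1) k l h x) hl rfl
  obtain ⟨m, h', hm⟩ := GenLocalCohomology.exists_map_eq_zero 𝔞 i M
    (x := y) (Subsingleton.elim _ _)
  rw [← GenLocalCohomology.of_map 𝔞 _ M h, ← GenLocalCohomology.of_map 𝔞 _ M h', ← hy]
  have : extQuotPowMap 𝔞 M N (i + 1) l m h' (y.comp hS.extClass rfl) =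
      Abelian.Ext.comp (extQuotPowMap 𝔞 M N'' i l m h' y) hS.extClass rfl :=
    (Abelian.Ext.comp_assoc _ _ _ (zero_add i) rfl (by omega)).symm
  rw [this, hm]
  simp

end Exactness

end ExtFunctoriality

/-! ### Reduction to finitely generated coefficients. -/

section FiniteSubmodules

variable {R : Type u} [CommRing R] [IsNoetherianRing R]

/-- Over a Noetherian ring, every class in `Ext^i(X, N)` with `X` finitely generated comes from a
finitely generated submodule of `N`. -/
lemma exists_fg_extPostcomp_subtype_eq (i : ℕ) (X : ModuleCat.{u} R) [Module.Finite R X]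
    {N : Type u} [AddCommGroup N] [Module R N]
    (x : Abelian.Ext.{u} X (ModuleCat.of R N) i) :
    ∃ P : Submodule R N, P.FG ∧ ∃ y, extPostcomp X i P.subtype y = x := by
  induction i generalizing X with
  | zero =>
    obtain ⟨φ, rfl⟩ := (Abelian.Ext.mk₀_bijective _ _).2 x
    refine ⟨LinearMap.range φ.hom, Module.Finite.iff_fg.mp inferInstance,
      Abelian.Ext.mk₀ (ModuleCat.ofHom φ.hom.rangeRestrict), ?_⟩
    simp only [extPostcomp, LinearMap.coe_mk, AddHom.coe_mk]
    rw [Abelian.Ext.mk₀_comp_mk₀]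
    rfl
  | succ i ih =>
    obtain ⟨m, φ, hφ⟩ := Module.Finite.exists_fin' R X
    obtain ⟨F, ψ, hψ, hF, hFP⟩ : ∃ (F : ModuleCat.{u} R) (ψ : F →ₗ[R] X), Function.Surjective ψ ∧
        Module.Finite R F ∧ Projective F :=
      ⟨ModuleCat.of R (Fin m → R), φ, hφ, inferInstanceAs (Module.Finite R (Fin m → R)),
        (IsProjective.iff_projective (Fin m → R)).mp inferInstance⟩
    -- Dimension shift: x comes from Ext^i of the first syzygy of X, which is again finitely
    -- generated because R is Noetherian.
    have hS := LinearMap.shortExact_shortComplexKer hψ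
    have : Module.Finite R ψ.shortComplexKer.X₁ :=
      inferInstanceAs (Module.Finite R (LinearMap.ker ψ))
    obtain ⟨x', hx'⟩ := Abelian.Ext.contravariant_sequence_exact₃ hS _ x
      (Abelian.Ext.eq_zero_of_projective _) (add_comm 1 i)
    obtain ⟨P, hP, y, hy⟩ := ih _ x'
    refine ⟨P, hP, hS.extClass.comp y (add_comm 1 i), ?_⟩
    rw [← hx', ← hy]
    simp only [extPostcomp, LinearMap.coe_mk, AddHom.coe_mk]
    rw [Abelian.Ext.comp_assoc _ _ _ _ _ (by omega)]

/-- Every class in `H^i_𝔞(M, N)` comes from a finitely generated submodule of `N`. -/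
lemma GenLocalCohomology.exists_fg (𝔞 : Ideal R) (i : ℕ) (M : Type u) [AddCommGroup M] [Module R M]
    [Module.Finite R M] {N : Type u} [AddCommGroup N] [Module R N]
    (z : GenLocalCohomology 𝔞 i M N) :
    ∃ P : Submodule R N, P.FG ∧ ∃ y, genLocalCohomologyMap 𝔞 i M P.subtype y = z := by
  obtain ⟨k, x, rfl⟩ := GenLocalCohomology.exists_of 𝔞 i M z
  have : Module.Finite R (ModuleCat.of R (M ⧸ (𝔞 ^ k • ⊤ : Submodule R M))) :=
    inferInstanceAs (Module.Finite R (M ⧸ (𝔞 ^ k • ⊤ : Submodule R M)))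
  obtain ⟨P, hP, y, rfl⟩ := exists_fg_extPostcomp_subtype_eq i _ x
  exact ⟨P, hP, GenLocalCohomology.of 𝔞 i M P k y, genLocalCohomologyMap_of ..⟩

end FiniteSubmodules

/-! ### Power torsion and injective hulls. -/

section PowTorsion

variable {R : Type u} [CommRing R] (𝔞 : Ideal R)

/-- The submodule `Γ_𝔞(N)` of elements annihilated by a power of `𝔞`. -/
def powTorsion (N : Type*) [AddCommGroup N] [Module R N] : Submodule R N where
  carrier := {y | ∃ k : ℕ, ∀ r ∈ 𝔞 ^ k, r • y = 0}
  add_mem' := by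
    rintro y z ⟨k, hk⟩ ⟨l, hl⟩
    refine ⟨k + l, fun r hr ↦ ?_⟩
    rw [smul_add, hk r (Ideal.pow_le_pow_right (Nat.le_add_right k l) hr),
      hl r (Ideal.pow_le_pow_right (Nat.le_add_left l k) hr), add_zero]
  zero_mem' := ⟨0, fun _ _ ↦ smul_zero _⟩
  smul_mem' := by
    rintro s y ⟨k, hk⟩
    exact ⟨k, fun r hr ↦ by rw [smul_comm, hk r hr, smul_zero]⟩

/-- A module is `𝔞`-power torsion if each element is annihilated by a power of `𝔞`. -/
def IsPowTorsion (N : Type*) [AddCommGroup N] [Module R N] : Prop :=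
  ∀ y : N, ∃ k : ℕ, ∀ r ∈ 𝔞 ^ k, r • y = 0

variable {𝔞} {N N' : Type*} [AddCommGroup N] [Module R N] [AddCommGroup N'] [Module R N']

lemma isPowTorsion_powTorsion : IsPowTorsion 𝔞 (powTorsion 𝔞 N) := fun ⟨_, k, hk⟩ ↦
  ⟨k, fun r hr ↦ Subtype.ext (hk r hr)⟩

lemma IsPowTorsion.of_surjective (h : IsPowTorsion 𝔞 N) {f : N →ₗ[R] N'}
    (hf : Function.Surjective f) : IsPowTorsion 𝔞 N' := by
  intro y
  obtain ⟨x, rfl⟩ := hf y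
  obtain ⟨k, hk⟩ := h x
  exact ⟨k, fun r hr ↦ by rw [← map_smul, hk r hr, map_zero]⟩

lemma IsPowTorsion.exists_pow_smul_apply_eq_zero (h : IsPowTorsion 𝔞 N') [Module.Finite R N]
    (f : N →ₗ[R] N') : ∃ k : ℕ, ∀ r ∈ 𝔞 ^ k, ∀ y, r • f y = 0 := by
  obtain ⟨s, hs⟩ := Module.Finite.fg_top (R := R) (M := N)
  choose k hk using h
  refine ⟨s.sup fun y ↦ k (f y), fun r hr y ↦ ?_⟩
  have : (⊤ : Submodule R N) ≤ LinearMap.ker (r • f) := by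
    rw [← hs, Submodule.span_le]
    exact fun y hy ↦ hk _ r (Ideal.pow_le_pow_right (Finset.le_sup (f := fun y ↦ k (f y)) hy) hr)
  exact this (Submodule.mem_top (x := y))

/-- A homomorphism from an ideal to an `𝔞`-power torsion module vanishes on the elements of a high
power of `𝔞`, by the Artin-Rees lemma. -/
lemma IsPowTorsion.exists_apply_eq_zero_of_mem_pow [IsNoetherianRing R] (h : IsPowTorsion 𝔞 N)
    (J : Ideal R) (g : J →ₗ[R] N) : ∃ n : ℕ, ∀ x : J, (x : R) ∈ 𝔞 ^ n → g x = 0 := by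
  obtain ⟨k, hk⟩ := h.exists_pow_smul_apply_eq_zero g
  obtain ⟨c, hc⟩ := Ideal.exists_pow_inf_eq_pow_smul 𝔞 (M := R) J
  have hle : 𝔞 ^ (k + c) ⊓ J ≤ 𝔞 ^ k • J := by
    have := hc (k + c) (Nat.le_add_left c k)
    rw [Nat.add_sub_cancel, smul_eq_mul, Ideal.mul_top] at this
    exact this.le.trans (Submodule.smul_mono le_rfl inf_le_right)
  have hker : 𝔞 ^ k • J ≤ (LinearMap.ker g).map J.subtype := by
    refine Submodule.smul_le.mpr fun r hr y hy ↦ ⟨r • ⟨y, hy⟩, ?_, rfl⟩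
    rw [SetLike.mem_coe, LinearMap.mem_ker, map_smul, hk r hr]
  refine ⟨k + c, fun x hxa ↦ ?_⟩
  obtain ⟨y, hy, hyx⟩ := hker (hle ⟨hxa, x.2⟩)
  obtain rfl : y = x := Subtype.ext hyx
  exact hy

/-- The `𝔞`-power torsion of an injective module over a Noetherian ring is injective. -/
lemma injective_powTorsion [IsNoetherianRing R] (I : Type u) [AddCommGroup I] [Module R I]
    [Module.Injective R I] : Module.Injective R (powTorsion 𝔞 I) := by
  refine Module.Baer.injective fun J g ↦ ?_
  obtain ⟨n, hn⟩ := isPowTorsion_powTorsion.exists_apply_eq_zero_of_mem_pow J g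
  -- Baer's criterion: g factors through the image of J in R/𝔞^n. Extending from there to R/𝔞^n,
  -- rather than to R, forces the values in I to be torsion.
  let φ : J →ₗ[R] R ⧸ (𝔞 ^ n) := Submodule.mkQ (𝔞 ^ n) ∘ₗ J.subtype
  have hφ : LinearMap.ker φ ≤ LinearMap.ker ((powTorsion 𝔞 I).subtype ∘ₗ g) := fun x hx ↦ by
    rw [LinearMap.mem_ker, LinearMap.comp_apply,
      hn x ((Submodule.Quotient.mk_eq_zero (𝔞 ^ n)).mp hx), map_zero]
  obtain ⟨h, hh⟩ := Module.Injective.extension_property R I _ _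
    ((LinearMap.ker φ).liftQ φ le_rfl)
    (LinearMap.ker_eq_bot.mp (Submodule.ker_liftQ_eq_bot _ _ _ le_rfl))
    ((LinearMap.ker φ).liftQ _ hφ)
  have htors : ∀ s, (h ∘ₗ Submodule.mkQ (𝔞 ^ n)) s ∈ powTorsion 𝔞 I := by
    refine fun s ↦ ⟨n, fun r hr ↦ ?_⟩
    have hrs : r • s ∈ 𝔞 ^ n := Ideal.mul_mem_right s _ hr
    rw [← map_smul, LinearMap.comp_apply, Submodule.mkQ_apply,
      (Submodule.Quotient.mk_eq_zero (𝔞 ^ n)).mpr hrs, map_zero]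
  refine ⟨(h ∘ₗ Submodule.mkQ (𝔞 ^ n)).codRestrict _ htors, fun x hx ↦ Subtype.ext ?_⟩
  exact LinearMap.congr_fun hh (Submodule.Quotient.mk (⟨x, hx⟩ : J))

/-- An `𝔞`-power torsion module over a Noetherian ring embeds into an `𝔞`-power torsion injective
module. -/
lemma IsPowTorsion.exists_injective [IsNoetherianRing R] {N : Type u} [AddCommGroup N] [Module R N]
    (h : IsPowTorsion 𝔞 N) :
    ∃ (E : Type u) (_ : AddCommGroup E) (_ : Module R E) (f : N →ₗ[R] E),
      Function.Injective f ∧ Module.Injective R E ∧ IsPowTorsion 𝔞 E := by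
  let I := Injective.under (ModuleCat.of R N)
  let ι : N →ₗ[R] I := (Injective.ι (ModuleCat.of R N)).hom
  have hι : Function.Injective ι :=
    (ModuleCat.mono_iff_injective (Injective.ι (ModuleCat.of R N))).mp inferInstance
  have : CategoryTheory.Injective (ModuleCat.of R I) :=
    inferInstanceAs (CategoryTheory.Injective I)
  have : Module.Injective R I := Module.injective_module_of_injective_object R I
  refine ⟨powTorsion 𝔞 I, inferInstance, inferInstance, ι.codRestrict _ fun y ↦ ?_, ?_,
    injective_powTorsion I, isPowTorsion_powTorsion⟩
  · obtain ⟨k, hk⟩ := h y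
    exact ⟨k, fun r hr ↦ by rw [← map_smul, hk r hr, map_zero]⟩
  · exact fun x y hxy ↦ hι (congrArg Subtype.val hxy)

end PowTorsion

/-! ### Power-torsion coefficients. -/

section TorsionCoefficients

variable {R : Type u} [CommRing R] {𝔞 : Ideal R}
  (M : Type u) [AddCommGroup M] [Module R M]

lemma genLocalCohomology_subsingleton_of_injective (i : ℕ) (E : Type u) [AddCommGroup E]
    [Module R E] [Module.Injective R E] : Subsingleton (GenLocalCohomology 𝔞 (i + 1) M E) := by
  refine subsingleton_of_forall_eq 0 fun z ↦ ?_
  obtain ⟨k, x, rfl⟩ := GenLocalCohomology.exists_of 𝔞 (i + 1) M z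
  have := Module.injective_object_of_injective_module R E
  rw [Abelian.Ext.eq_zero_of_injective x, map_zero]

variable [Module.Finite R M]

/-- A class at stage k is the coboundary of some γ : M/𝔞^k M → E/N. Pulled back to M, γ lifts to η :
M → E, the obstruction lying in Ext^1(M, N) = 0. As M is finitely generated and E is torsion, η
factors through M/𝔞^m M for large m, so the class dies at stage m. -/
lemma genLocalCohomology_one_subsingleton_of_isPowTorsion {N E : Type u}
    [AddCommGroup N] [Module R N] [AddCommGroup E] [Module R E] [Module.Injective R E]
    (hE : IsPowTorsion 𝔞 E) {f : N →ₗ[R] E} (hf : Function.Injective f)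
    (h : Subsingleton (Abelian.Ext.{u} (ModuleCat.of R M) (ModuleCat.of R N) 1)) :
    Subsingleton (GenLocalCohomology 𝔞 1 M N) := by
  refine subsingleton_of_forall_eq 0 fun z ↦ ?_
  obtain ⟨k, x, rfl⟩ := GenLocalCohomology.exists_of 𝔞 1 M z
  have hS := shortExact_of_exact hf f.exact_map_mkQ_range (Submodule.mkQ_surjective _)
  have := Module.injective_object_of_injective_module R E
  obtain ⟨y, hy⟩ := Abelian.Ext.covariant_sequence_exact₁ _ hS x
    (Abelian.Ext.eq_zero_of_injective (I := ModuleCat.of R E) _) (zero_add 1)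
  obtain ⟨γ, rfl⟩ := (Abelian.Ext.mk₀_bijective _ _).2 y
  let π (k : ℕ) : ModuleCat.of R M ⟶ ModuleCat.of R (M ⧸ (𝔞 ^ k • ⊤ : Submodule R M)) :=
    ModuleCat.ofHom (Submodule.mkQ _)
  obtain ⟨w, hw⟩ := Abelian.Ext.covariant_sequence_exact₃ (ModuleCat.of R M) hS
    (Abelian.Ext.mk₀ (π k ≫ γ)) (zero_add 1) (h.elim _ _)
  obtain ⟨η, rfl⟩ := (Abelian.Ext.mk₀_bijective _ _).2 w
  rw [Abelian.Ext.mk₀_comp_mk₀] at hw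
  replace hw := (Abelian.Ext.mk₀_bijective _ _).1 hw
  obtain ⟨l, hl⟩ := hE.exists_pow_smul_apply_eq_zero (N := M) (η.hom : M →ₗ[R] E)
  have hkm := le_max_left k l
  set m := max k l with hm
  let η' : (M ⧸ (𝔞 ^ m • ⊤ : Submodule R M)) →ₗ[R] E :=
    Submodule.liftQ _ (η.hom : M →ₗ[R] E) (Submodule.smul_le.mpr fun r hr y _ ↦ by
      rw [LinearMap.mem_ker, map_smul]
      exact hl r (Ideal.pow_le_pow_right (le_max_right k l) hr) y)
  have hη' : ModuleCat.ofHom η' ≫ ModuleCat.ofHom (LinearMap.range f).mkQ =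
      ModuleCat.ofHom (quotPowMap 𝔞 M hkm) ≫ γ := by
    ext t
    exact ConcreteCategory.congr_hom hw t
  rw [← GenLocalCohomology.of_map 𝔞 1 M hkm, ← hy]
  have hz : extQuotPowMap 𝔞 M N 1 k m hkm ((Abelian.Ext.mk₀ γ).comp hS.extClass (zero_add 1)) =
      (Abelian.Ext.mk₀ (ModuleCat.ofHom η')).comp
        ((Abelian.Ext.mk₀ (ModuleCat.ofHom (LinearMap.range f).mkQ)).comp hS.extClass
          (zero_add 1)) (zero_add 1) := by
    refine (Abelian.Ext.mk₀_comp_mk₀_assoc _ _ _).trans ?_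
    refine Eq.trans ?_ (Abelian.Ext.mk₀_comp_mk₀_assoc _ _ _).symm
    rw [hη']
  rw [hz]
  have : (Abelian.Ext.mk₀ (ModuleCat.ofHom (LinearMap.range f).mkQ)).comp hS.extClass
      (zero_add 1) = 0 := hS.comp_extClass
  rw [this]
  simp

/-- If `N` is `𝔞`-power torsion and `Ext^i(M, N) = 0` with `0 < i`, then `H^i_𝔞(M, N) = 0`. -/
lemma genLocalCohomology_subsingleton_of_isPowTorsion [IsNoetherianRing R] (i : ℕ)
    {N : Type u} [AddCommGroup N] [Module R N] (hN : IsPowTorsion 𝔞 N)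
    (h : Subsingleton (Abelian.Ext.{u} (ModuleCat.of R M) (ModuleCat.of R N) (i + 1))) :
    Subsingleton (GenLocalCohomology 𝔞 (i + 1) M N) := by
  induction i generalizing N with
  | zero =>
    obtain ⟨E, _, _, f, hf, hE, htE⟩ := hN.exists_injective
    exact genLocalCohomology_one_subsingleton_of_isPowTorsion M htE hf h
  | succ i ih =>
    obtain ⟨E, _, _, f, hf, hE, htE⟩ := hN.exists_injective
    have hS := shortExact_of_exact hf f.exact_map_mkQ_range (Submodule.mkQ_surjective _)
    have hEc := Module.injective_object_of_injective_module R E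
    -- Dimension shift: as E is injective, Ext^{i+1}(M, E/N) embeds in Ext^{i+2}(M, N) = 0.
    have hC : Subsingleton (Abelian.Ext.{u} (ModuleCat.of R M)
        (ModuleCat.of R (E ⧸ LinearMap.range f)) (i + 1)) := by
      refine subsingleton_of_forall_eq 0 fun x ↦ ?_
      obtain ⟨y, rfl⟩ := Abelian.Ext.covariant_sequence_exact₃ (ModuleCat.of R M) hS x rfl
        (h.elim _ _)
      rw [Abelian.Ext.eq_zero_of_injective (I := ModuleCat.of R E) y, Abelian.Ext.zero_comp]
    have := ih (htE.of_surjective (Submodule.mkQ_surjective (LinearMap.range f))) hC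
    have := genLocalCohomology_subsingleton_of_injective (𝔞 := 𝔞) M (i + 1) E
    exact (genLocalCohomologyMap_injective 𝔞 (i + 1) M hf f.exact_map_mkQ_range
      (Submodule.mkQ_surjective _)).subsingleton

end TorsionCoefficients

/-! ### Vanishing above pd M + dim N. -/

section Vanishing

variable {R : Type u} [CommRing R] (𝔞 : Ideal R)

/-- If `N` is finitely generated, `𝔞` contains a nonzerodivisor on `N / Γ_𝔞(N)`. -/
lemma exists_isSMulRegular_quotient_powTorsion [IsNoetherianRing R] (N : Type*) [AddCommGroup N]
    [Module R N] [Module.Finite R N] : ∃ x ∈ 𝔞, IsSMulRegular (N ⧸ powTorsion 𝔞 N) x := by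
  set N' := N ⧸ powTorsion 𝔞 N
  by_contra! hcon
  -- If 𝔞 consists of zerodivisors, prime avoidance puts it inside the annihilator of some y. Then
  -- 𝔞y is power torsion upstairs, and so is y since 𝔞 is finitely generated, whence the class of y
  -- is zero.
  have hsub : (𝔞 : Set R) ⊆ ⋃ p ∈ associatedPrimes R N', (p : Set R) := by
    rw [biUnion_associatedPrimes_eq_compl_regular R N']
    exact fun x hx ↦ hcon x hx
  obtain ⟨p, hp, hap⟩ := (Ideal.subset_union_prime_finite (associatedPrimes.finite R N') 0 0
    fun p hp _ _ ↦ IsAssociatedPrime.isPrime hp).mp hsub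
  obtain ⟨hpp, y, rfl⟩ := isAssociatedPrime_iff.mp hp
  obtain ⟨y, rfl⟩ := Submodule.mkQ_surjective _ y
  have hy : ∀ r ∈ 𝔞, r • y ∈ powTorsion 𝔞 N := fun r hr ↦ by
    have := Submodule.mem_colon_singleton.mp (hap hr)
    rw [← map_smul] at this
    exact (Submodule.Quotient.mk_eq_zero _).mp this
  let φ : 𝔞 →ₗ[R] powTorsion 𝔞 N :=
    (LinearMap.toSpanSingleton R N y ∘ₗ Submodule.subtype 𝔞).codRestrict _ fun r ↦ hy r r.2
  obtain ⟨k, hk⟩ := isPowTorsion_powTorsion.exists_pow_smul_apply_eq_zero φ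
  have hmem : y ∈ powTorsion 𝔞 N := by
    refine ⟨k + 1, fun r hr ↦ ?_⟩
    rw [pow_succ] at hr
    refine Submodule.mul_induction_on hr (fun s hs t ht ↦ ?_) fun s t hs ht ↦ ?_
    · rw [mul_smul]
      exact congrArg Subtype.val (hk s hs ⟨t, ht⟩)
    · rw [add_smul, hs, ht, add_zero]
  refine hpp.ne_top ((Ideal.eq_top_iff_one _).mpr ?_)
  rw [Submodule.mem_colon_singleton, one_smul]
  exact (Submodule.Quotient.mk_eq_zero _).mpr hmem

variable (M : Type u) [AddCommGroup M] [Module R M]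

open scoped Pointwise in
-- Multiplication by x is injective on the degree i + 1 cohomology, yet each element there is killed
-- by a power of x ∈ 𝔞.
lemma genLocalCohomology_subsingleton_of_isSMulRegular (i : ℕ) {N : Type u} [AddCommGroup N]
    [Module R N] {x : R} (hx : x ∈ 𝔞) (hreg : IsSMulRegular N x)
    [Subsingleton (GenLocalCohomology 𝔞 i M (QuotSMulTop x N))] :
    Subsingleton (GenLocalCohomology 𝔞 (i + 1) M N) := by
  have hex : Function.Exact (LinearMap.lsmul R N x) (Submodule.mkQ (x • (⊤ : Submodule R N))) := by
    intro y
    rw [Submodule.mkQ_apply, Submodule.Quotient.mk_eq_zero,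
      Submodule.mem_smul_pointwise_iff_exists]
    simp
  have hinj := genLocalCohomologyMap_injective 𝔞 i M (f := LinearMap.lsmul R N x) hreg hex
    (Submodule.mkQ_surjective _)
  refine subsingleton_of_forall_eq 0 fun z ↦ ?_
  obtain ⟨k, hk⟩ := GenLocalCohomology.exists_pow_smul_eq_zero 𝔞 (i + 1) M z
  have hreg' : IsSMulRegular (GenLocalCohomology 𝔞 (i + 1) M N) x := fun a b hab ↦
    hinj (by rw [genLocalCohomologyMap_lsmul, genLocalCohomologyMap_lsmul]; exact hab)
  exact (hreg'.pow k).right_eq_zero_of_smul (hk _ (Ideal.pow_mem_pow hx k))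

variable [IsNoetherianRing R] [Module.Finite R M]

/-- Vanishing of generalized local cohomology above `pd M + dim N`, for `N` finitely generated. -/
lemma genLocalCohomology_subsingleton_of_finite (d e : ℕ)
    [HasProjectiveDimensionLT (ModuleCat.of R M) (d + 1)] (N : Type u) [AddCommGroup N]
    [Module R N] [Module.Finite R N] (hN : Module.supportDim R N < e) (i : ℕ) (hi : d + e ≤ i) :
    Subsingleton (GenLocalCohomology 𝔞 i M N) := by
  induction e generalizing N i with
  | zero =>
    have : Subsingleton N := by
      by_contra h
      rw [not_subsingleton_iff_nontrivial] at h
      have := Module.supportDim_ne_bot_of_nontrivial R N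
      cases h' : Module.supportDim R N with
      | bot => exact this h'
      | coe a =>
        rw [h'] at hN
        simp at hN
    exact genLocalCohomology_subsingleton_of_subsingleton 𝔞 i M
  | succ e ih =>
    obtain ⟨j, rfl⟩ : ∃ j, i = j + 1 := ⟨i - 1, by omega⟩
    obtain ⟨x, hx, hreg⟩ := exists_isSMulRegular_quotient_powTorsion 𝔞 N
    -- Modulo its torsion, N has a nonzerodivisor x ∈ 𝔞, and dividing by x lowers the dimension. The
    -- torsion part is handled by Ext^{j+1}(M, -) = 0, as j + 1 > d.
    have hdim : Module.supportDim R (QuotSMulTop x (N ⧸ powTorsion 𝔞 N)) < e := by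
      have h1 := Module.supportDim_quotSMulTop_succ_le_of_notMem_minimalPrimes
        fun p hp ↦ hreg.notMem_of_mem_minimalPrimes hp
      have h2 := Module.supportDim_le_of_surjective (powTorsion 𝔞 N).mkQ
        (Submodule.mkQ_surjective _)
      have h3 := (h1.trans h2).trans_lt hN
      push_cast at h3
      exact lt_of_add_lt_add_right h3
    have := ih _ hdim j (by omega)
    have := genLocalCohomology_subsingleton_of_isSMulRegular 𝔞 M j hx hreg
    have := genLocalCohomology_subsingleton_of_isPowTorsion M j
      (isPowTorsion_powTorsion (𝔞 := 𝔞) (N := N))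
      (HasProjectiveDimensionLT.subsingleton _ (d + 1) _ (by omega) _)
    refine subsingleton_of_forall_eq 0 fun z ↦ ?_
    obtain ⟨y, rfl⟩ := genLocalCohomologyMap_exact 𝔞 (j + 1) M (powTorsion 𝔞 N).injective_subtype
      (LinearMap.exact_subtype_mkQ _) (Submodule.mkQ_surjective _) z (Subsingleton.elim _ _)
    rw [Subsingleton.elim y 0, map_zero]

/-- Vanishing of generalized local cohomology above `pd M + dim N`. -/
theorem genLocalCohomology_subsingleton_of_supportDim_lt (d e : ℕ)
    [HasProjectiveDimensionLT (ModuleCat.of R M) (d + 1)] (N : Type u) [AddCommGroup N]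
    [Module R N] (hN : Module.supportDim R N < e) (i : ℕ) (hi : d + e ≤ i) :
    Subsingleton (GenLocalCohomology 𝔞 i M N) := by
  refine subsingleton_of_forall_eq 0 fun z ↦ ?_
  obtain ⟨P, hP, y, rfl⟩ := GenLocalCohomology.exists_fg 𝔞 i M z
  have : Module.Finite R P := Module.Finite.iff_fg.mpr hP
  have := genLocalCohomology_subsingleton_of_finite 𝔞 M d e P
    ((Module.supportDim_le_of_injective P.subtype P.injective_subtype).trans_lt hN) i hi
  rw [Subsingleton.elim y 0, map_zero]

end Vanishing

/-! ### Secondary sums and their attached primes. -/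

section SecondaryDecomposition

variable {R : Type*} [CommRing R] {L : Type*} [AddCommGroup L] [Module R L]
  {ι : Type*} [Finite ι] {p : ι → Ideal R} {S : ι → Submodule R L}

lemma hasSecondaryRepresentation_of_iSup_eq_top (hS : ⨆ i, S i = ⊤)
    (hsurj : ∀ i, ∀ x ∉ p i, ∀ y ∈ S i, ∃ z ∈ S i, x • z = y)
    (hnil : ∀ i, ∀ x ∈ p i, ∃ k : ℕ, ∀ y ∈ S i, x ^ k • y = 0) :
    HasSecondaryRepresentation R L := by
  -- Secondary modules are nonzero, so zero summands are discarded.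
  let e := Finite.equivFin {i // S i ≠ ⊥}
  refine ⟨_, fun j ↦ S (e.symm j), fun j ↦ ⟨?_, fun x ↦ ?_⟩, ?_⟩
  · exact Submodule.nontrivial_iff_ne_bot.mpr (e.symm j).2
  · by_cases hx : x ∈ p (e.symm j)
    · obtain ⟨k, hk⟩ := hnil _ x hx
      refine Or.inr ⟨k, LinearMap.ext fun y ↦ Subtype.ext ?_⟩
      have hpow : ∀ m : ℕ, ((LinearMap.lsmul R (S (e.symm j)) x : Module.End R _) ^ m) y =
          x ^ m • y := by
        intro m
        induction m with
        | zero => simp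
        | succ m ih => rw [pow_succ', Module.End.mul_apply, ih, LinearMap.lsmul_apply, pow_succ',
            mul_smul]
      exact (congrArg Subtype.val (hpow k)).trans (hk y y.2)
    · refine Or.inl fun y ↦ ?_
      obtain ⟨z, hz, hzy⟩ := hsurj _ x hx y y.2
      exact ⟨⟨z, hz⟩, Subtype.ext hzy⟩
  · rw [← hS, e.symm.iSup_comp (g := fun i ↦ S i.1)]
    exact iSup_ne_bot_subtype S

/-- Otherwise each i admits some x_i ∉ P with x_i S_i ⊆ K: take 1 if S_i ⊆ K, and else a power of an
element of p_i \ P, since then P ⊊ p_i. The product of the x_i carries L into K, so it lies in the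
prime P, a contradiction. -/
lemma exists_eq_of_mem_attachedPrimes (hS : ⨆ i, S i = ⊤)
    (hsurj : ∀ i, ∀ x ∉ p i, ∀ y ∈ S i, ∃ z ∈ S i, x • z = y)
    (hnil : ∀ i, ∀ x ∈ p i, ∃ k : ℕ, ∀ y ∈ S i, x ^ k • y = 0)
    {P : Ideal R} (hP : P ∈ attachedPrimes R L) : ∃ i, S i ≠ ⊥ ∧ p i = P := by
  classical
  obtain ⟨hprime, K, hK⟩ := hP
  have hmem : ∀ {x}, x ∈ P ↔ ∀ y : L, x • y ∈ K := fun {x} ↦ by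
    rw [hK, Submodule.mem_colon]
    simp
  have hle : ∀ i, ¬ S i ≤ K → P ≤ p i := by
    intro i hi x hx
    by_contra hxp
    refine hi fun y hy ↦ ?_
    obtain ⟨z, -, rfl⟩ := hsurj i x hxp y hy
    exact hmem.mp hx z
  by_contra! hcon
  have hex : ∀ i, ∃ x ∉ P, ∀ y ∈ S i, x • y ∈ K := by
    intro i
    by_cases hi : S i ≤ K
    · exact ⟨1, hprime.one_notMem, fun y hy ↦ by rw [one_smul]; exact hi hy⟩
    · have hbot : S i ≠ ⊥ := fun h ↦ hi (h ▸ bot_le)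
      obtain ⟨x, hx, hxP⟩ := SetLike.not_le_iff_exists.mp fun h ↦
        hcon i hbot (le_antisymm h (hle i hi))
      obtain ⟨k, hk⟩ := hnil i x hx
      exact ⟨x ^ k, fun h ↦ hxP (hprime.mem_of_pow_mem k h),
        fun y hy ↦ by rw [hk y hy]; exact K.zero_mem⟩
  choose x hxP hx using hex
  have := Fintype.ofFinite ι
  have hprod : ∏ i, x i ∉ P := by
    rw [hprime.prod_mem_iff]
    rintro ⟨i, -, hi⟩
    exact hxP i hi
  refine hprod (hmem.mpr fun y ↦ ?_)
  have hle : (⊤ : Submodule R L) ≤ K.comap (LinearMap.lsmul R L (∏ i, x i)) := by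
    rw [← hS, iSup_le_iff]
    intro i y hy
    rw [Submodule.mem_comap, LinearMap.lsmul_apply,
      ← Finset.prod_erase_mul _ _ (Finset.mem_univ i), mul_smul]
    exact K.smul_mem _ (hx i y hy)
  exact hle Submodule.mem_top

end SecondaryDecomposition

/-! ### Localization at minimal primes and the pieces N_p. -/

section MinimalPrimes

variable {R : Type*} [CommRing R]

/-- No minimal prime of the ring lies in the support of the module. -/
def VanishesAtMinimalPrimes (R : Type*) [CommRing R] (X : Type*) [AddCommGroup X] [Module R X] :
    Prop :=
  ∀ q ∈ minimalPrimes R, ∀ y : X, ∃ s ∉ q, s • y = 0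

/-- A chain of length n in the support starts above a minimal prime outside the support; prepending
that prime would give a chain of length n + 1 in Spec R. -/
lemma VanishesAtMinimalPrimes.supportDim_lt {X : Type*} [AddCommGroup X] [Module R X] {n : ℕ}
    (h : VanishesAtMinimalPrimes R X) (hR : ringKrullDim R = n) : Module.supportDim R X < n := by
  by_contra! hn
  obtain ⟨l, hl⟩ := Order.le_krullDim_iff.mp hn
  obtain ⟨q, hq, hqp⟩ := Ideal.exists_minimalPrimes_le (bot_le (a := l.head.1.asIdeal))
  have hlt : (⟨q, hq.1.1⟩ : PrimeSpectrum R) < l.head.1 := by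
    refine lt_of_le_of_ne hqp fun heq ↦ ?_
    refine Module.notMem_support_iff'.mpr (fun y ↦ ?_) l.head.2
    rw [← heq]
    exact h q hq y
  let c := (l.map Subtype.val (fun _ _ h ↦ h)).cons (⟨q, hq.1.1⟩ : PrimeSpectrum R) hlt
  have hc : c.length = n + 1 := (RelSeries.cons_length ..).trans (congrArg (· + 1) hl)
  have := Order.LTSeries.length_le_krullDim c
  rw [show Order.krullDim (PrimeSpectrum R) = n from hR, hc] at this
  norm_cast at this
  omega

/-- That is, x is nilpotent in R_p: otherwise some prime avoids both R \ p and x, and lies strictly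
inside p. -/
lemma exists_mul_pow_eq_zero_of_mem_minimalPrimes {p : Ideal R} (hp : p ∈ minimalPrimes R)
    {x : R} (hx : x ∈ p) : ∃ u ∉ p, ∃ k : ℕ, u * x ^ k = 0 := by
  have := hp.1.1
  by_contra! hcon
  have hdisj : Disjoint ((⊥ : Ideal R) : Set R)
      (p.primeCompl ⊔ Submonoid.powers x : Submonoid R) := by
    rw [Set.disjoint_left]
    rintro y hy hyS
    obtain ⟨u, hu, _, ⟨k, rfl⟩, rfl⟩ := Submonoid.mem_sup.mp hyS
    exact hcon u hu k hy
  obtain ⟨q, hq, -, hqS⟩ := Ideal.exists_le_prime_disjoint _ _ hdisj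
  have hqp : q ≤ p := fun y hy ↦ by
    by_contra hyp
    exact Set.disjoint_left.mp hqS hy (Submonoid.mem_sup_left (S := p.primeCompl) hyp)
  exact Set.disjoint_left.mp hqS (hp.2 ⟨hq, bot_le⟩ hqp hx)
    (Submonoid.mem_sup_right (Submonoid.mem_powers x))

/-- The elements of `N` vanishing at all minimal primes of the ring other than `p`. -/
def minimalPrimeComponent (p : Ideal R) (N : Type*) [AddCommGroup N] [Module R N] :
    Submodule R N where
  carrier := {y | ∀ q ∈ minimalPrimes R, q ≠ p → ∃ s ∉ q, s • y = 0}
  add_mem' := by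
    intro y z hy hz q hq hqp
    obtain ⟨s, hs, hsy⟩ := hy q hq hqp
    obtain ⟨t, ht, htz⟩ := hz q hq hqp
    refine ⟨s * t, fun h ↦ (hq.1.1.mem_or_mem h).elim hs ht, ?_⟩
    rw [smul_add, mul_smul s t z, htz, mul_comm, mul_smul, hsy, smul_zero, smul_zero, add_zero]
  zero_mem' := fun q hq _ ↦ ⟨1, hq.1.1.one_notMem, smul_zero _⟩
  smul_mem' := by
    intro r y hy q hq hqp
    obtain ⟨s, hs, hsy⟩ := hy q hq hqp
    exact ⟨s, hs, by rw [smul_comm, hsy, smul_zero]⟩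

variable {N : Type*} [AddCommGroup N] [Module R N]

lemma exists_smul_eq_zero_of_mem_minimalPrimeComponent {p q : Ideal R} (hq : q ∈ minimalPrimes R)
    (hqp : q ≠ p) (y : minimalPrimeComponent p N) : ∃ s ∉ q, s • y = 0 := by
  obtain ⟨s, hs, hsy⟩ := y.2 q hq hqp
  exact ⟨s, hs, Subtype.ext hsy⟩

/-- For each minimal q ≠ p, some power of an element of q \ p is zero in R_q. The product of these
powers over the finitely many q avoids p. -/
lemma exists_smul_mem_minimalPrimeComponent [IsNoetherianRing R] {p : Ideal R}
    (hp : p ∈ minimalPrimes R) : ∃ s ∉ p, ∀ y : N, s • y ∈ minimalPrimeComponent p N := by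
  classical
  have hone : ∀ q : minimalPrimes R, ∃ s ∉ p, q.1 ≠ p → ∃ u ∉ q.1, u * s = 0 := by
    intro q
    by_cases hqp : q.1 = p
    · exact ⟨1, hp.1.1.one_notMem, fun h ↦ (h hqp).elim⟩
    · obtain ⟨t, htq, htp⟩ := SetLike.not_le_iff_exists.mp fun h ↦
        hqp (le_antisymm h (hp.2 q.2.1 h))
      obtain ⟨u, hu, k, huk⟩ := exists_mul_pow_eq_zero_of_mem_minimalPrimes q.2 htq
      exact ⟨t ^ k, fun h ↦ htp (hp.1.1.mem_of_pow_mem k h), fun _ ↦ ⟨u, hu, huk⟩⟩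
  choose s hsp hs using hone
  have : Finite (minimalPrimes R) := minimalPrimes.finite_of_isNoetherianRing R
  have := Fintype.ofFinite (minimalPrimes R)
  refine ⟨∏ q, s q, ?_, fun y q hq hqp ↦ ?_⟩
  · rw [hp.1.1.prod_mem_iff]
    rintro ⟨q, -, h⟩
    exact hsp q h
  · obtain ⟨u, hu, h0⟩ := hs ⟨q, hq⟩ hqp
    refine ⟨u, hu, ?_⟩
    rw [← Finset.mul_prod_erase _ _ (Finset.mem_univ (⟨q, hq⟩ : minimalPrimes R)), smul_smul,
      ← mul_assoc, h0, zero_mul, zero_smul]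

lemma vanishesAtMinimalPrimes_quotient_iSup_minimalPrimeComponent [IsNoetherianRing R] :
    VanishesAtMinimalPrimes R
      (N ⧸ ⨆ p : minimalPrimes R, minimalPrimeComponent p.1 N) := by
  intro p hp y
  obtain ⟨y, rfl⟩ := Submodule.mkQ_surjective _ y
  obtain ⟨s, hs, h⟩ := exists_smul_mem_minimalPrimeComponent (N := N) hp
  refine ⟨s, hs, ?_⟩
  rw [← map_smul]
  exact (Submodule.Quotient.mk_eq_zero _).mpr
    (Submodule.mem_iSup_of_mem (⟨p, hp⟩ : minimalPrimes R) (h y))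

/-- A minimal prime of a Noetherian ring in the support of a module is associated to it. -/
lemma mem_associatedPrimes_of_mem_minimalPrimes [IsNoetherianRing R] {p : Ideal R}
    (hp : p ∈ minimalPrimes R) {y : N} (hy : ∀ s ∉ p, s • y ≠ 0) : p ∈ associatedPrimes R N := by
  -- The annihilator of y lies in p, and p is minimal over it because p is minimal in R.
  have hmin : p ∈ ((⊥ : Submodule R N).colon {y}).minimalPrimes := by
    refine ⟨⟨hp.1.1, fun s hs ↦ ?_⟩, fun q hq hqp ↦ hp.2 ⟨hq.1, bot_le⟩ hqp⟩
    by_contra hsp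
    exact hy s hsp (Submodule.mem_colon_singleton.mp hs)
  exact isAssociatedPrime_iff.mpr
    ⟨hp.1.1, Submodule.exists_eq_colon_of_mem_minimalPrimes hmin⟩

end MinimalPrimes

/-! ### The functor in top degree d + n. -/

section TopCohomology

variable {R : Type u} [CommRing R] [IsNoetherianRing R] (𝔞 : Ideal R)
  (M : Type u) [AddCommGroup M] [Module R M] [Module.Finite R M] {d n : ℕ}
  [HasProjectiveDimensionLT (ModuleCat.of R M) (d + 1)]

lemma genLocalCohomology_subsingleton_of_lt (hR : ringKrullDim R = n) (X : Type u)
    [AddCommGroup X] [Module R X] {i : ℕ} (hi : d + n < i) :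
    Subsingleton (GenLocalCohomology 𝔞 i M X) := by
  -- The vanishing theorem needs a strict bound, so dim X ≤ n enters as dim X < n + 1.
  refine genLocalCohomology_subsingleton_of_supportDim_lt 𝔞 M d (n + 1) X ?_ i (by omega)
  refine ((Module.supportDim_le_ringKrullDim R X).trans hR.le).trans_lt ?_
  exact_mod_cast Nat.lt_succ_self n

lemma VanishesAtMinimalPrimes.subsingleton (hR : ringKrullDim R = n) {X : Type u}
    [AddCommGroup X] [Module R X] (h : VanishesAtMinimalPrimes R X) :
    Subsingleton (GenLocalCohomology 𝔞 (d + n) M X) :=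
  genLocalCohomology_subsingleton_of_supportDim_lt 𝔞 M d n X (h.supportDim_lt hR) _ le_rfl

/-- Right exactness: factor f through its image. The obstruction from the kernel sits in degree d +
n + 1, where everything vanishes. -/
lemma genLocalCohomologyMap_surjective_of_cokernel (hR : ringKrullDim R = n) {A B : Type u}
    [AddCommGroup A] [Module R A] [AddCommGroup B] [Module R B] (f : A →ₗ[R] B)
    [Subsingleton (GenLocalCohomology 𝔞 (d + n) M (B ⧸ LinearMap.range f))] :
    Function.Surjective (genLocalCohomologyMap 𝔞 (d + n) M f) := by
  have hf : f = (LinearMap.range f).subtype ∘ₗ f.rangeRestrict := rfl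
  have hker : Function.Exact (LinearMap.ker f).subtype f.rangeRestrict := by
    have := LinearMap.exact_subtype_ker_map f.rangeRestrict
    rwa [LinearMap.ker_rangeRestrict] at this
  have := genLocalCohomology_subsingleton_of_lt 𝔞 M (d := d) hR (LinearMap.ker f)
    (Nat.lt_succ_self (d + n))
  rw [hf, genLocalCohomologyMap_comp, LinearMap.coe_comp]
  refine Function.Surjective.comp (fun z ↦ ?_) ?_
  · exact genLocalCohomologyMap_exact 𝔞 (d + n) M (LinearMap.range f).injective_subtype
      (LinearMap.exact_subtype_mkQ _) (Submodule.mkQ_surjective _) z (Subsingleton.elim _ _)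
  · exact genLocalCohomologyMap_surjective 𝔞 (d + n) M (LinearMap.ker f).injective_subtype hker
      f.surjective_rangeRestrict

/-- Right exactness applied to the sum map from the finite product of the X_j to N. -/
lemma iSup_range_genLocalCohomologyMap (hR : ringKrullDim R = n) {ι : Type u} [Finite ι]
    {X : ι → Type u} [∀ j, AddCommGroup (X j)] [∀ j, Module R (X j)] {N : Type u} [AddCommGroup N]
    [Module R N] (f : ∀ j, X j →ₗ[R] N)
    (h : Subsingleton (GenLocalCohomology 𝔞 (d + n) M (N ⧸ ⨆ j, LinearMap.range (f j)))) :
    ⨆ j, LinearMap.range (genLocalCohomologyMap 𝔞 (d + n) M (f j)) = ⊤ := by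
  classical
  have := Fintype.ofFinite ι
  let φ : (∀ j, X j) →ₗ[R] N := ∑ j, f j ∘ₗ LinearMap.proj j
  have hφ : LinearMap.range φ = ⨆ j, LinearMap.range (f j) := by
    refine le_antisymm ?_ (iSup_le fun j ↦ ?_)
    · rintro _ ⟨x, rfl⟩
      simp only [φ, LinearMap.sum_apply]
      exact Submodule.sum_mem _ fun j _ ↦ Submodule.mem_iSup_of_mem j ⟨x j, rfl⟩
    · rintro _ ⟨x, rfl⟩
      refine ⟨Pi.single j x, ?_⟩
      simp only [φ, LinearMap.sum_apply, LinearMap.comp_apply, LinearMap.proj_apply]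
      rw [Finset.sum_eq_single j (fun k _ hk ↦ by rw [Pi.single_eq_of_ne hk, map_zero])
        (fun hj ↦ (hj (Finset.mem_univ j)).elim), Pi.single_eq_same]
  rw [← hφ] at h
  rw [eq_top_iff]
  rintro z -
  obtain ⟨y, rfl⟩ := genLocalCohomologyMap_surjective_of_cokernel 𝔞 M hR φ z
  simp only [φ, genLocalCohomologyMap_sum, LinearMap.sum_apply, genLocalCohomologyMap_comp]
  exact Submodule.sum_mem _ fun j _ ↦ Submodule.mem_iSup_of_mem j ⟨_, rfl⟩

/-- The cokernel of x on N_p is killed by x ∉ p, and it vanishes at the other minimal primes because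
N_p does. -/
lemma smul_surjective_genLocalCohomology_minimalPrimeComponent (hR : ringKrullDim R = n)
    (N : Type u) [AddCommGroup N] [Module R N] {p : Ideal R} {x : R} (hx : x ∉ p)
    (y : GenLocalCohomology 𝔞 (d + n) M (minimalPrimeComponent p N)) : ∃ z, x • z = y := by
  have hv : VanishesAtMinimalPrimes R (minimalPrimeComponent p N ⧸
      LinearMap.range (LinearMap.lsmul R (minimalPrimeComponent p N) x)) := by
    intro q hq y
    obtain ⟨y, rfl⟩ := Submodule.mkQ_surjective _ y
    by_cases hqp : q = p
    · subst hqp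
      refine ⟨x, hx, ?_⟩
      rw [← map_smul]
      exact (Submodule.Quotient.mk_eq_zero _).mpr ⟨y, rfl⟩
    · obtain ⟨s, hs, hsy⟩ := exists_smul_eq_zero_of_mem_minimalPrimeComponent hq hqp y
      exact ⟨s, hs, by rw [← map_smul, hsy, map_zero]⟩
  have := hv.subsingleton 𝔞 M (d := d) hR
  obtain ⟨z, rfl⟩ := genLocalCohomologyMap_surjective_of_cokernel 𝔞 M hR
    (LinearMap.lsmul R (minimalPrimeComponent p N) x) y
  exact ⟨z, (genLocalCohomologyMap_lsmul 𝔞 _ M x z).symm⟩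

/-- With u ∉ p and u x^k = 0, the module x^k N_p vanishes at every minimal prime, and x^k acts on
cohomology through that of x^k N_p, which is zero. -/
lemma exists_pow_smul_genLocalCohomology_minimalPrimeComponent (hR : ringKrullDim R = n)
    (N : Type u) [AddCommGroup N] [Module R N] {p : Ideal R} (hp : p ∈ minimalPrimes R) {x : R}
    (hx : x ∈ p) : ∃ k : ℕ, ∀ z : GenLocalCohomology 𝔞 (d + n) M (minimalPrimeComponent p N),
      x ^ k • z = 0 := by
  obtain ⟨u, hu, k, huk⟩ := exists_mul_pow_eq_zero_of_mem_minimalPrimes hp hx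
  refine ⟨k, fun z ↦ ?_⟩
  let f := LinearMap.lsmul R (minimalPrimeComponent p N) (x ^ k)
  have hv : VanishesAtMinimalPrimes R (LinearMap.range f) := by
    rintro q hq ⟨_, y, rfl⟩
    by_cases hqp : q = p
    · subst hqp
      refine ⟨u, hu, Subtype.ext ?_⟩
      change u • x ^ k • y = 0
      rw [smul_smul, huk, zero_smul]
    · obtain ⟨s, hs, hsy⟩ := exists_smul_eq_zero_of_mem_minimalPrimeComponent hq hqp y
      exact ⟨s, hs, Subtype.ext (by
        change s • f y = 0
        rw [← map_smul, hsy, map_zero])⟩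
  have := hv.subsingleton 𝔞 M (d := d) hR
  have hf : f = (LinearMap.range f).subtype ∘ₗ f.rangeRestrict := rfl
  rw [← genLocalCohomologyMap_lsmul, show LinearMap.lsmul R _ (x ^ k) = f from rfl, hf,
    genLocalCohomologyMap_comp, LinearMap.comp_apply, Subsingleton.elim (genLocalCohomologyMap 𝔞
      (d + n) M f.rangeRestrict z) 0, map_zero]

/-- Each finitely generated submodule of X is a quotient of a finite power of R/p, and such
submodules supply every class. -/
lemma genLocalCohomology_subsingleton_of_isTorsionBy (hR : ringKrullDim R = n) {p : Ideal R}
    [Subsingleton (GenLocalCohomology 𝔞 (d + n) M (R ⧸ p))] {X : Type u} [AddCommGroup X]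
    [Module R X] (hX : ∀ r ∈ p, ∀ y : X, r • y = 0) :
    Subsingleton (GenLocalCohomology 𝔞 (d + n) M X) := by
  refine subsingleton_of_forall_eq 0 fun z ↦ ?_
  obtain ⟨P, hP, z, rfl⟩ := GenLocalCohomology.exists_fg 𝔞 (d + n) M z
  obtain ⟨s, hs⟩ := (Module.Finite.iff_fg.mpr hP).fg_top
  let f (y : s) : (R ⧸ p) →ₗ[R] P := Submodule.liftQ p (LinearMap.toSpanSingleton R P y.1)
    fun r hr ↦ Subtype.ext (hX r hr y.1)
  have hf : (⨆ y, LinearMap.range (f y)) = ⊤ := by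
    rw [eq_top_iff, ← hs, Submodule.span_le]
    exact fun y hy ↦ Submodule.mem_iSup_of_mem ⟨y, hy⟩
      ⟨Submodule.Quotient.mk 1, one_smul R y⟩
  have : Subsingleton (P ⧸ ⨆ y, LinearMap.range (f y)) :=
    Submodule.Quotient.subsingleton_iff.mpr hf
  have htop := iSup_range_genLocalCohomologyMap 𝔞 M (d := d) hR f
    (genLocalCohomology_subsingleton_of_subsingleton 𝔞 _ M)
  have hbot : (⊤ : Submodule R (GenLocalCohomology 𝔞 (d + n) M P)) ≤ ⊥ := by
    rw [← htop, iSup_le_iff]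
    rintro y _ ⟨w, rfl⟩
    rw [Subsingleton.elim w 0, map_zero]
    exact Submodule.zero_mem _
  rw [(Submodule.mem_bot R).mp (hbot (Submodule.mem_top (x := z))), map_zero]

/-- If the top cohomology of R/p vanished, so would that of N / pN. Generators of p would then have
images summing to the whole top cohomology of N, while each image lies in K. -/
lemma nontrivial_of_mem_attachedPrimes (hR : ringKrullDim R = n) {N : Type u} [AddCommGroup N]
    [Module R N] {p : Ideal R} (hp : p ∈ attachedPrimes R (GenLocalCohomology 𝔞 (d + n) M N)) :
    Nontrivial (GenLocalCohomology 𝔞 (d + n) M (R ⧸ p)) := by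
  by_contra hcon
  rw [not_nontrivial_iff_subsingleton] at hcon
  obtain ⟨hprime, K, hK⟩ := hp
  obtain ⟨s, hs⟩ := (isNoetherianRing_iff_ideal_fg R).mp ‹_› p
  let f (r : s) : N →ₗ[R] N := LinearMap.lsmul R N r.1
  have hle : p ≤ (⨆ r, LinearMap.range (f r)).colon Set.univ := by
    rw [← hs, Submodule.span_le]
    exact fun r hr ↦ Submodule.mem_colon.mpr fun y _ ↦
      Submodule.mem_iSup_of_mem ⟨r, hr⟩ ⟨y, rfl⟩
  have htop := iSup_range_genLocalCohomologyMap 𝔞 M (d := d) hR f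
    (genLocalCohomology_subsingleton_of_isTorsionBy 𝔞 M hR (p := p) fun r hr y ↦ by
      obtain ⟨y, rfl⟩ := Submodule.mkQ_surjective _ y
      rw [← map_smul]
      exact (Submodule.Quotient.mk_eq_zero _).mpr (Submodule.mem_colon.mp (hle hr) y trivial))
  have hKtop : (⊤ : Submodule R _) ≤ K := by
    rw [← htop, iSup_le_iff]
    rintro r _ ⟨w, rfl⟩
    rw [genLocalCohomologyMap_lsmul]
    have hr : r.1 ∈ p := hs ▸ Submodule.subset_span r.2
    rw [hK] at hr
    exact Submodule.mem_colon.mp hr w trivial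
  refine hprime.one_notMem ?_
  rw [hK]
  exact Submodule.mem_colon.mpr fun y _ ↦ hKtop trivial

lemma genCohomDim_eq_of_nontrivial (hR : ringKrullDim R = n) (X : Type u) [AddCommGroup X]
    [Module R X] (h : Nontrivial (GenLocalCohomology 𝔞 (d + n) M X)) :
    genCohomDim 𝔞 M X = ((d + n : ℕ) : WithBot ℕ∞) := by
  refine le_antisymm (sSup_le ?_) (le_sSup ⟨d + n, rfl, h⟩)
  rintro _ ⟨i, rfl, hi⟩
  have hle : i ≤ d + n := by
    by_contra! hlt
    exact not_subsingleton_iff_nontrivial.mpr hi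
      (genLocalCohomology_subsingleton_of_lt 𝔞 M hR X hlt)
  exact_mod_cast hle

end TopCohomology

/-! ### Assembly of the main theorem. -/

theorem theorem3p4 {R : Type u} [CommRing R] [IsNoetherianRing R] [IsLocalRing R] (𝔞 : Ideal R)
    (M N : Type u) [AddCommGroup M] [Module R M] [Module.Finite R M]
    [AddCommGroup N] [Module R N] (d n : ℕ)
    (hM : projectiveDimension (ModuleCat.of R M) = (d : WithBot ℕ∞))
    (hN : Module.supportDim R N = (n : WithBot ℕ∞))
    (hR : ringKrullDim R = (n : WithBot ℕ∞)) :
    HasSecondaryRepresentation R (GenLocalCohomology 𝔞 (d + n) M N) ∧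
      attachedPrimes R (GenLocalCohomology 𝔞 (d + n) M N) ⊆
        {p | p ∈ associatedPrimes R N ∧
          genCohomDim 𝔞 M (R ⧸ p) = ((d + n : ℕ) : WithBot ℕ∞)} := by
  have hpd : HasProjectiveDimensionLT (ModuleCat.of R M) (d + 1) :=
    (projectiveDimension_le_iff _ d).mp hM.le
  have : Finite (minimalPrimes R) := minimalPrimes.finite_of_isNoetherianRing R
  let S (p : minimalPrimes R) : Submodule R (GenLocalCohomology 𝔞 (d + n) M N) :=
    LinearMap.range (genLocalCohomologyMap 𝔞 (d + n) M (minimalPrimeComponent p.1 N).subtype)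
  have hS : ⨆ p, S p = ⊤ := by
    refine iSup_range_genLocalCohomologyMap 𝔞 M hR
      (fun p : minimalPrimes R ↦ (minimalPrimeComponent p.1 N).subtype) ?_
    have hr : (⨆ p : minimalPrimes R, LinearMap.range (minimalPrimeComponent p.1 N).subtype) =
        ⨆ p : minimalPrimes R, minimalPrimeComponent p.1 N := by
      simp only [Submodule.range_subtype]
    rw [hr]
    exact vanishesAtMinimalPrimes_quotient_iSup_minimalPrimeComponent.subsingleton 𝔞 M hR
  have hsurj : ∀ p : minimalPrimes R, ∀ x ∉ p.1, ∀ y ∈ S p, ∃ z ∈ S p, x • z = y := by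
    rintro p x hx _ ⟨y, rfl⟩
    obtain ⟨z, rfl⟩ :=
      smul_surjective_genLocalCohomology_minimalPrimeComponent 𝔞 M hR N hx y
    exact ⟨_, ⟨z, rfl⟩, (map_smul _ _ _).symm⟩
  have hnil : ∀ p : minimalPrimes R, ∀ x ∈ p.1, ∃ k : ℕ, ∀ y ∈ S p, x ^ k • y = 0 := by
    intro p x hx
    obtain ⟨k, hk⟩ :=
      exists_pow_smul_genLocalCohomology_minimalPrimeComponent 𝔞 M (d := d) hR N p.2 hx
    refine ⟨k, ?_⟩
    rintro _ ⟨y, rfl⟩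
    rw [← map_smul, hk, map_zero]
  refine ⟨hasSecondaryRepresentation_of_iSup_eq_top hS hsurj hnil, fun P hP ↦ ⟨?_, ?_⟩⟩
  · obtain ⟨p, hbot, rfl⟩ := exists_eq_of_mem_attachedPrimes hS hsurj hnil hP
    by_contra hass
    -- An element of N_p not vanishing at the minimal prime p would make p associated to N.
    have hv : VanishesAtMinimalPrimes R (minimalPrimeComponent p.1 N) := by
      intro q hq y
      by_cases hqp : q = p.1
      · subst hqp
        by_contra! hy
        exact hass (mem_associatedPrimes_of_mem_minimalPrimes hq (y := y.1) fun s hs h ↦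
          hy s hs (Subtype.ext h))
      · exact exists_smul_eq_zero_of_mem_minimalPrimeComponent hq hqp y
    have := hv.subsingleton 𝔞 M (d := d) hR
    refine hbot (eq_bot_iff.mpr ?_)
    rintro _ ⟨y, rfl⟩
    rw [Subsingleton.elim y 0, map_zero]
    exact Submodule.zero_mem _
  · exact genCohomDim_eq_of_nontrivial 𝔞 M hR _ (nontrivial_of_mem_attachedPrimes 𝔞 M hR hP)
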